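/- For $n\ge 1$ let $G=(V,E)$ be the complete graph on $n$ vertices, and let $X=(X_e)_{e\in E}$ be independent real random variables with $|X_e|\le 1$ almost surely, each having a density with respect to Lebesgue measure that is bounded above by $\phi$ (where $\phi$ and the laws of the $X_e$ may depend on $n$). For a spin configuration $\sigma\in\{-1,1\}^V$ let $$\mathbf{H}(\sigma)=-\frac12\sum_{uv\in E}X_{uv}\,\sigma(u)\sigma(v).$$ A move flips the sign of $\sigma$ at a single vertex. A sequence of moves is called $\epsilon$-slowly improving from an initial configuration $\sigma_0$ if, when it is performed starting from $\sigma_0$, each step increases $\mathbf{H}$ by more than $0$ and by at most $\epsilon$. Fix $\eta>0$ and let $\epsilon=n^{-(12+\eta)}\phi^{-5}$. Then with high probability there are no initial configuration $\sigma_0\in\{-1,1\}^V$ and sequence of $2n$ moves that is $\epsilon$-slowly improving from $\sigma_0$. That is, there is a function $r(n)\to0$ as $n\to\infty$, depending only on $\eta$, such that for all such $n$, $\phi$ and $X$ the probability that no such $\sigma_0$ and sequence exist is at least $1-r(n)$. -/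

import Mathlib

open MeasureTheory ProbabilityTheory Filter Topology

/-- The edges of the complete graph on the vertex set `Fin n`. -/
abbrev Edge (n : ℕ) : Type := (⊤ : SimpleGraph (Fin n)).edgeSet

/-- Spin configurations `σ : V → {-1, 1}`; the group `ℤˣ` of units of `ℤ` is `{-1, 1}`. -/
abbrev Config (n : ℕ) : Type := Fin n → ℤˣ

/-- The product `σ(u) σ(v)`, as a real number, for an unordered pair `e = uv`. -/
def spinProd {n : ℕ} (σ : Config n) (e : Sym2 (Fin n)) : ℝ :=
  Sym2.lift ⟨fun u v => ((σ u : ℤ) : ℝ) * ((σ v : ℤ) : ℝ), fun _ _ => mul_comm _ _⟩ e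

/-- The Hamiltonian `H(σ) = -1/2 ∑_{uv ∈ E} w(uv) σ(u) σ(v)` for edge weights `w`. -/
noncomputable def hamiltonian {n : ℕ} (w : Edge n → ℝ) (σ : Config n) : ℝ :=
  -(1 / 2) * ∑ e : Edge n, w e * spinProd σ e

/-- The configuration obtained from `σ` by flipping the spin at the vertex `v`. -/
def flipAt {n : ℕ} (σ : Config n) (v : Fin n) : Config n :=
  Function.update σ v (-σ v)

/-- The configuration reached from `σ₀` after the first `t` moves of the sequence
`L = (v₁, v₂, …)`, where the `i`-th move flips the spin at `vᵢ`. -/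
def configAt {n : ℕ} (σ₀ : Config n) (L : List (Fin n)) (t : ℕ) : Config n :=
  (L.take t).foldl flipAt σ₀

/-- The sequence of moves `L` is `ε`-slowly improving from `σ₀`, for the edge weights `w`:
each step increases the Hamiltonian by more than `0` and by at most `ε`. -/
def IsSlowlyImproving {n : ℕ} (w : Edge n → ℝ) (ε : ℝ) (σ₀ : Config n)
    (L : List (Fin n)) : Prop :=
  ∀ t < L.length,
    0 < hamiltonian w (configAt σ₀ L (t + 1)) - hamiltonian w (configAt σ₀ L t) ∧
    hamiltonian w (configAt σ₀ L (t + 1)) - hamiltonian w (configAt σ₀ L t) ≤ ε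

/-- The random edge weights `X` on the probability space `(Ω, P)` are independent, almost surely
bounded by `1` in absolute value, and each has a density with respect to Lebesgue measure that is
(essentially) bounded above by `φ`. -/
structure IsSmoothedWeights {n : ℕ} {Ω : Type*} [MeasurableSpace Ω] (P : Measure Ω)
    (X : Edge n → Ω → ℝ) (φ : ℝ) : Prop where
  indep : iIndepFun X P
  bounded : ∀ e, ∀ᵐ ω ∂P, |X e ω| ≤ 1
  hasPDF : ∀ e, HasPDF (X e) P volume
  density_le : ∀ e, ∀ᵐ x : ℝ, pdf (X e) P volume x ≤ ENNReal.ofReal φ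

/-! The proof is a union bound over short blocks of moves rather than over whole sequences. Among `2
n` moves on `n` vertices, a shortest block whose length `m` is at least twice its number of distinct
vertices is critical (`exists_isCritical`).

For two consecutive flips of the same vertex `v` in the block, add the two energy increments. The
spin of `v` has changed sign in between, so an edge `vu` cancels unless `u` flips an odd number of
times between them, and then it has coefficient `±2`. The resulting form depends only on the block
and on the initial spins of its vertices. It lies in `(0, 2 ε]`, and positivity shows that it is not
zero.

In a critical block at least `m / 8` of these forms can be ordered triangularly: each has an edge
absent from the later ones (`exists_isPeelable`). Integrating out these edges one after another
gives probability at most `(2 φ ε) ^ k` with `8 k ≥ m` (`pi_slab_le`). There are at most `(2 n) ^ m`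
choices of vertices and spins, so the bound sums to a geometric series once `2 φ ε ≤ y ^ 8` with `n
y` small. -/

/-- An affine condition with leading coefficient at least `1` in absolute value that confines a
real number to an interval of length `δ` has Lebesgue measure at most `δ`. -/
theorem volume_affine_preimage_Ioc_le (a b δ : ℝ) (ha : 1 ≤ |a|) :
    volume {x : ℝ | 0 < b + x * a ∧ b + x * a ≤ δ} ≤ ENNReal.ofReal δ := by
  have ha0 : a ≠ 0 := by
    rintro rfl
    norm_num at ha
  have hset : {x : ℝ | 0 < b + x * a ∧ b + x * a ≤ δ}
      = (fun x => x * a) ⁻¹' ((fun x => b + x) ⁻¹' Set.Ioc 0 δ) := rfl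
  rw [hset, Real.volume_preimage_mul_right ha0, measure_preimage_add, Real.volume_Ioc, sub_zero]
  calc ENNReal.ofReal |a⁻¹| * ENNReal.ofReal δ ≤ 1 * ENNReal.ofReal δ := by
        gcongr
        rw [ENNReal.ofReal_le_one, abs_inv]
        exact inv_le_one_of_one_le₀ ha
    _ = _ := one_mul _

/-! ### Small-ball estimates for triangular families of linear forms. -/

section Peeling

variable {E ι : Type*} [Fintype E]

/-- The set of points at which each of the linear forms `a i`, `i ∈ I`, takes a value
in `(0, δ]`. -/
def slab (a : ι → E → ℝ) (δ : ℝ) (I : Finset ι) : Set (E → ℝ) :=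
  {x | ∀ i ∈ I, 0 < ∑ e, x e * a i e ∧ ∑ e, x e * a i e ≤ δ}

theorem measurableSet_slab (a : ι → E → ℝ) (δ : ℝ) (I : Finset ι) :
    MeasurableSet (slab a δ I) := by
  have : slab a δ I = ⋂ i ∈ I, (fun x : E → ℝ => ∑ e, x e * a i e) ⁻¹' Set.Ioc 0 δ := by
    ext x; simp [slab]
  rw [this]
  refine Finset.measurableSet_biInter _ fun i _ => ?_
  exact measurableSet_Ioc.preimage (by fun_prop)

variable [DecidableEq E]

theorem sum_update_mul (x : E → ℝ) (e : E) (y : ℝ) (a : E → ℝ) :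
    ∑ e', Function.update x e y e' * a e' = ∑ e' ∈ Finset.univ.erase e, x e' * a e' + y * a e := by
  rw [← Finset.sum_erase_add _ _ (Finset.mem_univ e), Function.update_self]
  congr 1
  refine Finset.sum_congr rfl fun e' he' => ?_
  rw [Function.update_of_ne (Finset.ne_of_mem_erase he')]

/-- If a coordinate `e` occurs with coefficient at least `1` in the form `a i` and in none of the
forms indexed by `J`, then requiring the form `a i` to lie in `(0, δ]` costs a factor `c * δ`. -/
theorem pi_slab_insert_le [DecidableEq ι] (ν : E → Measure ℝ) [∀ e, IsProbabilityMeasure (ν e)]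
    (c : ENNReal) (hν : ∀ e S, ν e S ≤ c * volume S) (a : ι → E → ℝ) (δ : ℝ)
    (J : Finset ι) (i : ι) (e : E) (hi : 1 ≤ |a i e|) (hJ : ∀ j ∈ J, a j e = 0) :
    Measure.pi ν (slab a δ (insert i J)) ≤ c * ENNReal.ofReal δ * Measure.pi ν (slab a δ J) := by
  have hinv : ∀ (x : E → ℝ) (y : ℝ), Function.update x e y ∈ slab a δ J ↔ x ∈ slab a δ J := by
    intro x y
    refine forall₂_congr fun j hj => ?_
    have : ∑ e', Function.update x e y e' * a j e' = ∑ e', x e' * a j e' := by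
      rw [sum_update_mul, ← Finset.sum_erase_add _ (fun e' => x e' * a j e') (Finset.mem_univ e),
        hJ j hj]
      simp
    rw [this]
  have hm1 := measurableSet_slab a δ (insert i J)
  have hm2 := measurableSet_slab a δ J
  have hf1 : Measurable ((slab a δ (insert i J)).indicator (fun _ => (1 : ENNReal))) :=
    measurable_const.indicator hm1
  have hf2 : Measurable ((slab a δ J).indicator (fun _ => (1 : ENNReal))) :=
    measurable_const.indicator hm2
  rw [← lintegral_indicator_one hm1, ← lintegral_indicator_one hm2]
  change ∫⁻ x, (slab a δ (insert i J)).indicator (fun _ => (1 : ENNReal)) x ∂_ ≤ _ *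
    ∫⁻ x, (slab a δ J).indicator (fun _ => (1 : ENNReal)) x ∂_
  -- Tonelli with the coordinate `e` innermost: the slab of `J` is constant along it, so only the
  -- one-dimensional condition on `a i` remains in the inner integral.
  rw [lintegral_eq_lmarginal_univ (μ := ν) (0 : E → ℝ),
    lintegral_eq_lmarginal_univ (μ := ν) (0 : E → ℝ),
    lmarginal_erase' _ hf1 (Finset.mem_univ e), lmarginal_erase' _ hf2 (Finset.mem_univ e)]
  unfold lmarginal
  rw [← lintegral_const_mul]
  · refine lintegral_mono fun x' => ?_
    generalize Function.updateFinset (0 : E → ℝ) (Finset.univ.erase e) x' = x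
    by_cases hx : x ∈ slab a δ J
    · have h1 : ∀ y, (slab a δ J).indicator (fun _ => (1 : ENNReal)) (Function.update x e y) = 1 :=
        fun y => Set.indicator_of_mem ((hinv x y).2 hx) _
      simp only [h1, lintegral_const, measure_univ, mul_one]
      have hms : MeasurableSet {y : ℝ | Function.update x e y ∈ slab a δ (insert i J)} :=
        hm1.preimage (measurable_update x)
      calc ∫⁻ y, (slab a δ (insert i J)).indicator (fun _ => (1 : ENNReal))
              (Function.update x e y) ∂ν e
          = ν e {y : ℝ | Function.update x e y ∈ slab a δ (insert i J)} := by
            rw [← lintegral_indicator_one hms]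
            rfl
        _ ≤ ν e {y : ℝ | 0 < ∑ e' ∈ Finset.univ.erase e, x e' * a i e' + y * a i e ∧
              ∑ e' ∈ Finset.univ.erase e, x e' * a i e' + y * a i e ≤ δ} := by
            refine measure_mono fun y hy => ?_
            have := hy i (Finset.mem_insert_self i J)
            rwa [sum_update_mul] at this
        _ ≤ c * volume _ := hν e _
        _ ≤ c * ENNReal.ofReal δ := by
            gcongr
            exact volume_affine_preimage_Ioc_le _ _ _ hi
    · have h1 : ∀ y, (slab a δ (insert i J)).indicator (fun _ => (1 : ENNReal))
          (Function.update x e y) = 0 := by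
        intro y
        refine Set.indicator_of_notMem (fun hy => hx ((hinv x y).1 ?_)) _
        exact fun j hj => hy j (Finset.mem_insert_of_mem hj)
      simp [h1]
  · have h : Measurable fun p : ((i : Finset.univ.erase e) → ℝ) × ℝ =>
        Function.update (Function.updateFinset (0 : E → ℝ) (Finset.univ.erase e) p.1) e p.2 := by
      refine measurable_pi_iff.2 fun k => ?_
      by_cases hk : k = e
      · subst hk
        simpa using measurable_snd
      · simp only [Function.update_of_ne hk, Function.updateFinset]
        split_ifs <;> fun_prop
    exact (hf2.comp h).lintegral_prod_right'

/-- Let `a i`, `i ∈ I`, be linear forms such that every nonempty subfamily has a member with a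
coefficient of size at least `1` at a coordinate which occurs in no other member. Under a product
measure whose factors have density at most `c`, all of them lie in `(0, δ]` with probability at
most `(c δ) ^ |I|`. -/
theorem pi_slab_le [DecidableEq ι] (ν : E → Measure ℝ) [∀ e, IsProbabilityMeasure (ν e)]
    (c : ENNReal) (hν : ∀ e S, ν e S ≤ c * volume S) (a : ι → E → ℝ) (δ : ℝ) (I : Finset ι)
    (hI : ∀ J ⊆ I, J.Nonempty → ∃ i ∈ J, ∃ e, 1 ≤ |a i e| ∧ ∀ j ∈ J, j ≠ i → a j e = 0) :
    Measure.pi ν (slab a δ I) ≤ (c * ENNReal.ofReal δ) ^ I.card := by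
  induction I using Finset.strongInduction with
  | H I ih =>
    rcases I.eq_empty_or_nonempty with rfl | hne
    · simpa using prob_le_one
    · obtain ⟨i, hi, e, h1, h2⟩ := hI I subset_rfl hne
      have hss := Finset.erase_ssubset hi
      have := ih _ hss fun J hJ => hI J (hJ.trans hss.subset)
      rw [← Finset.card_erase_add_one hi, pow_succ', ← Finset.insert_erase hi,
        Finset.erase_insert (Finset.notMem_erase i I)]
      refine (pi_slab_insert_le ν c hν a δ _ i e h1 fun j hj => ?_).trans ?_
      · exact h2 j (Finset.mem_of_mem_erase hj) (Finset.ne_of_mem_erase hj)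
      · gcongr

end Peeling

/-! ### Combinatorics of repeated values in a finite sequence. -/

section Blocks

variable {ι V : Type*} [LinearOrder ι]

/-- Positions `i < j` are consecutive occurrences of the same value of `b`. -/
def IsNext (b : ι → V) (i j : ι) : Prop :=
  i < j ∧ b j = b i ∧ ∀ p, i < p → p < j → b p ≠ b i

theorem IsNext.unique_of_mem {b : ι → V} {i j i' j' p : ι} (h : IsNext b i j)
    (h' : IsNext b i' j') (hb : b i = b i') (h1 : i < p) (h2 : p < j) (h1' : i' < p)
    (h2' : p < j') : i = i' := by
  rcases lt_trichotomy i i' with hlt | heq | hgt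
  · exact absurd hb.symm (h.2.2 i' hlt (h1'.trans h2))
  · exact heq
  · exact absurd hb (h'.2.2 i hgt (h1.trans h2'))

variable [Fintype ι] [DecidableEq V]

theorem exists_isNext (b : ι → V) {i k : ι} (hik : i < k) (hb : b k = b i) :
    ∃ j ≤ k, IsNext b i j := by
  have hne : (Finset.univ.filter fun j => i < j ∧ b j = b i).Nonempty := ⟨k, by simp [hik, hb]⟩
  obtain ⟨h1, h2⟩ := (Finset.mem_filter.1 (Finset.min'_mem _ hne)).2
  refine ⟨_, Finset.min'_le _ k (by simp [hik, hb]), h1, h2, fun p hp hpj hbp => ?_⟩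
  exact absurd (Finset.min'_le _ p (by simp [hp, hbp])) (not_le.2 hpj)

/-- The number of occurrences of `u` strictly between the positions `i` and `j`. -/
def occ (b : ι → V) (u : V) (i j : ι) : ℕ :=
  (Finset.univ.filter fun p => i < p ∧ p < j ∧ b p = u).card

theorem occ_pos_iff {b : ι → V} {u : V} {i j : ι} :
    0 < occ b u i j ↔ ∃ p, i < p ∧ p < j ∧ b p = u := by
  simp [occ, Finset.card_pos, Finset.Nonempty]

/-- One endpoint of the pair `{v, u}` is the value at `i`, and the other one occurs an odd number of
times between `i` and `j`. -/
def InGap (b : ι → V) (i j : ι) (v u : V) : Prop :=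
  (b i = v ∧ Odd (occ b u i j)) ∨ (b i = u ∧ Odd (occ b v i j))

/-- A position whose value occurs nowhere else. -/
def IsSingle (b : ι → V) (i : ι) : Prop := ∀ p, b p = b i → p = i

/-- Every nonempty part of `I` contains a gap with an edge that is used by no other gap of that
part. -/
def IsPeelable (b : ι → V) (nx : ι → ι) (I : Finset ι) : Prop :=
  ∀ J ⊆ I, J.Nonempty → ∃ i ∈ J, ∃ u, u ≠ b i ∧ Odd (occ b u i (nx i)) ∧
    ∀ i' ∈ J, i' ≠ i → ¬ InGap b i' (nx i') (b i) u

/-- The edge joining `b i` to a single value inside its gap is private to that gap: gaps of the same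
value are disjoint, and a single value starts no gap of its own. -/
theorem isPeelable_of_single {b : ι → V} {nx : ι → ι} {I : Finset ι}
    (hnx : ∀ i ∈ I, IsNext b i (nx i))
    (hI : ∀ i ∈ I, ∃ p, i < p ∧ p < nx i ∧ IsSingle b p) : IsPeelable b nx I := by
  intro J hJ ⟨i, hi⟩
  obtain ⟨p, hip, hpj, hp⟩ := hI i (hJ hi)
  refine ⟨i, hi, b p, (hnx i (hJ hi)).2.2 p hip hpj, ?_, ?_⟩
  · have : occ b (b p) i (nx i) = 1 := by
      rw [occ, Finset.card_eq_one]
      refine ⟨p, Finset.eq_singleton_iff_unique_mem.2 ⟨by simp [hip, hpj], fun q hq => ?_⟩⟩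
      exact hp q (Finset.mem_filter.1 hq).2.2.2
    rw [this]
    exact odd_one
  · rintro i' hi' hne (⟨hb, ho⟩ | ⟨hb, -⟩)
    · obtain ⟨q, h1, h2, h3⟩ := occ_pos_iff.1 ho.pos
      obtain rfl := hp q h3
      exact hne ((hnx i' (hJ hi')).unique_of_mem (hnx i (hJ hi)) hb h1 h2 hip hpj)
    · obtain rfl := hp i' hb
      have := hnx i' (hJ hi')
      exact this.1.ne' (hp _ this.2.1)

/-- Peel the gap with the largest value `b i`. Another gap using the edge to `u i > b i` would start
at `b i`, against injectivity, or at `u i`, against maximality. -/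
theorem isPeelable_of_injOn [LinearOrder V] {b : ι → V} {nx : ι → ι} {I : Finset ι} (u : ι → V)
    (hu : ∀ i ∈ I, b i < u i ∧ Odd (occ b (u i) i (nx i))) (hinj : Set.InjOn b I) :
    IsPeelable b nx I := by
  intro J hJ hne
  obtain ⟨i, hi, hmax⟩ := J.exists_max_image b hne
  refine ⟨i, hi, u i, (hu i (hJ hi)).1.ne', (hu i (hJ hi)).2, ?_⟩
  rintro i' hi' hne (⟨hb, -⟩ | ⟨hb, -⟩)
  · exact hne (hinj (hJ hi') (hJ hi) hb)
  · exact absurd (hmax i' hi') (not_le.2 (hb ▸ (hu i (hJ hi)).1))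

/-- Positions whose value does not occur later have distinct values. -/
theorem injOn_of_not_exists_next (b : ι → V) :
    Set.InjOn b {i | ¬ ∃ j, IsNext b i j} := by
  intro i hi k hk hb
  rcases lt_trichotomy i k with h | h | h
  · obtain ⟨j, -, hj⟩ := exists_isNext b h hb.symm
    exact absurd ⟨j, hj⟩ hi
  · exact h
  · obtain ⟨j, -, hj⟩ := exists_isNext b h hb
    exact absurd ⟨j, hj⟩ hk

/-! ### Many peelable gaps in a critical sequence. -/

section Counting

open Classical in
/-- In a sequence all of whose proper intervals `B` have `|B| ≤ 2 |b '' B|`, the positions with a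
repeated value which are last in their run between single positions make up at least half of all
positions with a repeated value. -/
theorem card_not_single_le (b : ι → V) (hex : ∃ i, IsSingle b i)
    (hcrit : ∀ i j : ι, Finset.univ.filter (fun p => i ≤ p ∧ p ≤ j) ≠ Finset.univ →
      (Finset.univ.filter fun p => i ≤ p ∧ p ≤ j).card ≤
        2 * ((Finset.univ.filter fun p => i ≤ p ∧ p ≤ j).image b).card) :
    (Finset.univ.filter fun i => ¬ IsSingle b i).card ≤
      2 * (Finset.univ.filter fun i => ¬ IsSingle b i ∧
        ∀ k, i < k → b k = b i → ∃ p, i < p ∧ p < k ∧ IsSingle b p).card := by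
  -- Counting the single positions before `i` labels the run that contains `i`; the non-single
  -- positions with a given label form an interval.
  set label : ι → ℕ := fun i => (Finset.univ.filter fun p => p < i ∧ IsSingle b p).card
  have hmono : Monotone label := fun i j hij =>
    Finset.card_le_card fun p hp => by
      simp only [Finset.mem_filter, Finset.mem_univ, true_and] at hp ⊢
      exact ⟨hp.1.trans_le hij, hp.2⟩
  have hlt : ∀ p j, IsSingle b p → p < j → label p < label j := fun p j hp hpj =>
    Finset.card_lt_card <| by
      refine Finset.ssubset_iff_of_subset (fun q hq => ?_) |>.2 ⟨p, ?_, ?_⟩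
      · simp only [Finset.mem_filter, Finset.mem_univ, true_and] at hq ⊢
        exact ⟨hq.1.trans hpj, hq.2⟩
      · simp [hpj, hp]
      · simp
  have heq : ∀ i k, i ≤ k → label i = label k → ¬ IsSingle b k →
      ∀ p, i ≤ p → p ≤ k → ¬ IsSingle b p := by
    intro i k hik hl hk p hip hpk hp
    rcases hpk.lt_or_eq with h | rfl
    · have := hlt p k hp h
      have := hmono hip
      omega
    · exact hk hp
  set S := Finset.univ.filter fun i => ¬ IsSingle b i
  set Q := Finset.univ.filter fun i => ¬ IsSingle b i ∧
        ∀ k, i < k → b k = b i → ∃ p, i < p ∧ p < k ∧ IsSingle b p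
  have hQS : Q ⊆ S := fun i hi => by
    simp only [Q, S, Finset.mem_filter, Finset.mem_univ, true_and] at hi ⊢
    exact hi.1
  rw [Finset.card_eq_sum_card_fiberwise (f := label) (t := S.image label)
      (fun i hi => Finset.mem_image_of_mem _ hi),
    Finset.card_eq_sum_card_fiberwise (s := Q) (f := label) (t := S.image label)
      (fun i hi => Finset.mem_image_of_mem _ (hQS hi)), Finset.mul_sum]
  refine Finset.sum_le_sum fun l hl => ?_
  have hne : (S.filter fun i => label i = l).Nonempty := by
    obtain ⟨i, hi, rfl⟩ := Finset.mem_image.1 hl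
    exact ⟨i, by simp [hi]⟩
  set T := S.filter fun i => label i = l with hT
  have memT : ∀ i, i ∈ T ↔ ¬ IsSingle b i ∧ label i = l := fun i => by simp [hT, S]
  have hmin := (memT _).1 (T.min'_mem hne)
  have hmax := (memT _).1 (T.max'_mem hne)
  have hTI : T = Finset.univ.filter fun p => T.min' hne ≤ p ∧ p ≤ T.max' hne := by
    ext p
    simp only [Finset.mem_filter, Finset.mem_univ, true_and]
    refine ⟨fun hp => ⟨T.min'_le p hp, T.le_max' p hp⟩, fun ⟨h1, h2⟩ => (memT p).2 ⟨?_, ?_⟩⟩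
    · exact heq _ _ (h1.trans h2) (hmin.2.trans hmax.2.symm) hmax.1 p h1 h2
    · have := hmono h1
      have := hmono h2
      omega
  -- A single position lies outside every run, so each run is a proper interval and `hcrit` applies
  -- to it.
  have hTu : T ≠ Finset.univ := by
    obtain ⟨p, hp⟩ := hex
    intro h
    exact ((memT p).1 (h ▸ Finset.mem_univ p)).1 hp
  have h1 : T.card ≤ 2 * (T.image b).card := by
    have := hcrit (T.min' hne) (T.max' hne)
    rw [← hTI] at this
    exact this hTu
  refine h1.trans (Nat.mul_le_mul_left 2 ?_)
  -- The last occurrence of a value within its run belongs to `Q`: any later occurrence lies beyond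
  -- a single position.
  have : T.image b ⊆ (Q.filter fun i => label i = l).image b := by
    intro v hv
    obtain ⟨i, hi, rfl⟩ := Finset.mem_image.1 hv
    have hne' : (T.filter fun k => b k = b i).Nonempty := ⟨i, by simp [hi]⟩
    obtain ⟨k, hk, hkmax⟩ := Finset.exists_max_image _ id hne'
    rw [Finset.mem_filter] at hk
    refine Finset.mem_image.2 ⟨k, ?_, hk.2⟩
    have hkT := (memT k).1 hk.1
    simp only [Q, Finset.mem_filter, Finset.mem_univ, true_and]
    refine ⟨⟨hkT.1, fun m hkm hbm => ?_⟩, hkT.2⟩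
    by_contra! hcon
    have hmS : ¬ IsSingle b m := fun hm => hkm.ne (hm k hbm.symm)
    have hsub : label m ≤ label k := by
      refine Finset.card_le_card fun p hp => ?_
      simp only [Finset.mem_filter, Finset.mem_univ, true_and] at hp ⊢
      refine ⟨lt_of_le_of_ne (not_lt.1 fun h => hcon p h hp.1 hp.2) ?_, hp.2⟩
      rintro rfl
      exact hkT.1 hp.2
    have hmT : m ∈ T := (memT m).2 ⟨hmS, le_antisymm (hkT.2 ▸ hsub) (hkT.2 ▸ hmono hkm.le)⟩
    exact absurd (hkmax m (Finset.mem_filter.2 ⟨hmT, hbm.trans hk.2⟩)) (not_le.2 hkm)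
  exact (Finset.card_le_card this).trans Finset.card_image_le

open Classical in
/-- A sequence of length twice the number of its values, in which every proper interval `B` has
`|B| ≤ 2 |b '' B|` and every gap between consecutive occurrences of a value contains some value an
odd number of times, has a peelable set of gaps of size at least an eighth of its length. -/
theorem exists_isPeelable [LinearOrder V] (b : ι → V)
    (hcard : Fintype.card ι = 2 * (Finset.univ.image b).card)
    (hcrit : ∀ i j : ι, Finset.univ.filter (fun p => i ≤ p ∧ p ≤ j) ≠ Finset.univ →
      (Finset.univ.filter fun p => i ≤ p ∧ p ≤ j).card ≤
        2 * ((Finset.univ.filter fun p => i ≤ p ∧ p ≤ j).image b).card)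
    (hodd : ∀ i j, IsNext b i j → ∃ u ≠ b i, Odd (occ b u i j)) :
    ∃ (nx : ι → ι) (I : Finset ι), (∀ i ∈ I, IsNext b i (nx i)) ∧ IsPeelable b nx I ∧
      Fintype.card ι ≤ 8 * I.card := by
  have hnx : ∃ nx : ι → ι, ∀ i, (∃ j, IsNext b i j) → IsNext b i (nx i) :=
    ⟨fun i => if h : ∃ j, IsNext b i j then h.choose else i, fun i h => by
      simpa [h] using h.choose_spec⟩
  obtain ⟨nx, hnx⟩ := hnx
  have hu : ∃ u : ι → V, ∀ i, (∃ j, IsNext b i j) → u i ≠ b i ∧ Odd (occ b (u i) i (nx i)) := by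
    have : ∀ i, ∃ v, (∃ j, IsNext b i j) → v ≠ b i ∧ Odd (occ b v i (nx i)) := fun i => by
      by_cases h : ∃ j, IsNext b i j
      · obtain ⟨v, hv⟩ := hodd i _ (hnx i h)
        exact ⟨v, fun _ => hv⟩
      · exact ⟨b i, fun h' => absurd h' h⟩
    exact ⟨fun i => (this i).choose, fun i => (this i).choose_spec⟩
  obtain ⟨u, hu⟩ := hu
  set S1 := Finset.univ.filter fun i => IsSingle b i with hS1
  set S2 := Finset.univ.filter fun i => ¬ IsSingle b i with hS2
  set F := Finset.univ.filter fun i => (∃ j, IsNext b i j) ∧ ∀ p < i, b p ≠ b i with hF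
  set Z := S2.filter fun i => ¬ ∃ j, IsNext b i j with hZ
  have hS : S1.card + S2.card = Fintype.card ι := Finset.card_filter_add_card_filter_not _
  have hFinj : Set.InjOn b F := by
    intro i hi k hk hb
    have hi := (Finset.mem_filter.1 hi).2.2
    have hk := (Finset.mem_filter.1 hk).2.2
    rcases lt_trichotomy i k with h | h | h
    · exact absurd hb (hk i h)
    · exact h
    · exact absurd hb.symm (hi k h)
  have hZinj : Set.InjOn b Z :=
    (injOn_of_not_exists_next b).mono fun i hi => (Finset.mem_filter.1 hi).2
  have hS1inj : Set.InjOn b S1 := fun i _ k hk hb => (Finset.mem_filter.1 hk).2 i hb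
  -- values are single or repeated
  have hFcard : F.card = (S2.image b).card := by
    rw [← Finset.card_image_of_injOn hFinj]
    congr 1
    ext v
    simp only [Finset.mem_image]
    constructor
    · rintro ⟨i, hi, rfl⟩
      obtain ⟨⟨j, hj⟩, -⟩ := (Finset.mem_filter.1 hi).2
      exact ⟨i, Finset.mem_filter.2 ⟨Finset.mem_univ _, fun h => hj.1.ne' (h j hj.2.1)⟩, rfl⟩
    · rintro ⟨i, hi, rfl⟩
      obtain ⟨k, hk, hkmin⟩ := Finset.exists_min_image
        (Finset.univ.filter fun k => b k = b i) id ⟨i, by simp⟩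
      have hbk := (Finset.mem_filter.1 hk).2
      have hmin : ∀ p < k, b p ≠ b k := fun p hp hb =>
        absurd (hkmin p (by simp [hb, hbk])) (not_le.2 hp)
      refine ⟨k, Finset.mem_filter.2 ⟨Finset.mem_univ _, ?_, hmin⟩, hbk⟩
      by_contra hno
      refine (Finset.mem_filter.1 hi).2 fun p hp => ?_
      have key : ∀ q, b q = b i → q = k := fun q hq => by
        rcases lt_trichotomy q k with h | h | h
        · exact absurd (hq.trans hbk.symm) (hmin q h)
        · exact h
        · obtain ⟨j, -, hj⟩ := exists_isNext b h (hq.trans hbk.symm)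
          exact absurd ⟨j, hj⟩ hno
      rw [key p hp, key i rfl]
  have hZcard : Z.card ≤ (S2.image b).card := by
    rw [← Finset.card_image_of_injOn hZinj]
    exact Finset.card_le_card (Finset.image_subset_image (Finset.filter_subset _ _))
  have hval : (Finset.univ.image b).card = S1.card + (S2.image b).card := by
    rw [← Finset.card_image_of_injOn hS1inj, ← Finset.card_union_of_disjoint]
    · rw [← Finset.image_union, hS1, hS2, Finset.filter_union_filter_not_eq]
    · rw [Finset.disjoint_left]
      intro v hv hv'
      obtain ⟨i, hi, rfl⟩ := Finset.mem_image.1 hv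
      obtain ⟨k, hk, hki⟩ := Finset.mem_image.1 hv'
      have := (Finset.mem_filter.1 hi).2 k hki
      exact (Finset.mem_filter.1 hk).2 (this ▸ (Finset.mem_filter.1 hi).2)
  by_cases hcase : S1.card ≤ (S2.image b).card
  · -- many repeated values: use their first gaps
    have hsplit : (F.filter fun i => b i < u i).card + (F.filter fun i => ¬ b i < u i).card
        = F.card := Finset.card_filter_add_card_filter_not _
    have hFn : ∀ i ∈ F, ∃ j, IsNext b i j := fun i hi => (Finset.mem_filter.1 hi).2.1
    -- Single and repeated values together number half the length, so `F` has at least a quarter of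
    -- the length and the larger of its two parts at least an eighth.
    rcases le_total (F.filter fun i => ¬ b i < u i).card (F.filter fun i => b i < u i).card
      with h | h
    · refine ⟨nx, F.filter fun i => b i < u i, fun i hi => ?_, ?_, by omega⟩
      · exact hnx i (hFn i (Finset.mem_filter.1 hi).1)
      · refine isPeelable_of_injOn u (fun i hi => ?_)
          (hFinj.mono (Finset.coe_subset.2 (Finset.filter_subset _ _)))
        obtain ⟨h1, h2⟩ := Finset.mem_filter.1 hi
        exact ⟨h2, (hu i (hFn i h1)).2⟩
    · refine ⟨nx, F.filter fun i => ¬ b i < u i, fun i hi => ?_, ?_, by omega⟩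
      · exact hnx i (hFn i (Finset.mem_filter.1 hi).1)
      · refine isPeelable_of_injOn (V := Vᵒᵈ) (b := b) u (fun i hi => ?_)
          (hFinj.mono (Finset.coe_subset.2 (Finset.filter_subset _ _)))
        obtain ⟨h1, h2⟩ := Finset.mem_filter.1 hi
        have := hu i (hFn i h1)
        exact ⟨lt_of_le_of_ne (not_lt.1 h2) this.1.symm, this.2⟩
  · -- many single values: use the gaps which contain one
    have hex : ∃ i, IsSingle b i := by
      have : 0 < S1.card := by omega
      obtain ⟨i, hi⟩ := Finset.card_pos.1 this
      exact ⟨i, (Finset.mem_filter.1 hi).2⟩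
    have hQ := card_not_single_le b hex hcrit
    rw [← hS2] at hQ
    set Q := Finset.univ.filter fun i => ¬ IsSingle b i ∧
        ∀ k, i < k → b k = b i → ∃ p, i < p ∧ p < k ∧ IsSingle b p
    have hQI : ∀ i ∈ Q.filter (fun i => ∃ j, IsNext b i j), IsNext b i (nx i) := fun i hi =>
      hnx i (Finset.mem_filter.1 hi).2
    refine ⟨nx, Q.filter fun i => ∃ j, IsNext b i j, hQI, ?_, ?_⟩
    · refine isPeelable_of_single hQI fun i hi => ?_
      have hn := hQI i hi
      exact (Finset.mem_filter.1 (Finset.mem_filter.1 hi).1).2.2 _ hn.1 hn.2.1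
    · have h1 : (Q.filter fun i => ∃ j, IsNext b i j).card
          + (Q.filter fun i => ¬ ∃ j, IsNext b i j).card = Q.card :=
        Finset.card_filter_add_card_filter_not _
      have h2 : (Q.filter fun i => ¬ ∃ j, IsNext b i j).card ≤ Z.card := by
        refine Finset.card_le_card fun i hi => ?_
        obtain ⟨h1, h2⟩ := Finset.mem_filter.1 hi
        exact Finset.mem_filter.2 ⟨Finset.mem_filter.2
          ⟨Finset.mem_univ _, (Finset.mem_filter.1 h1).2.1⟩, h2⟩
      -- With `s` single and `r` repeated values the length is `2 (s + r)`, so `S2` has `s + 2 r`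
      -- elements and `Q` at least half of that. Removing at most `r` final occurrences leaves at
      -- least `s / 2`, which suffices because `s > r`.
      omega

end Counting

end Blocks

/-! ### Energy increments as linear forms in the edge weights. -/

theorem spinProd_mk {n : ℕ} (σ : Config n) (u v : Fin n) :
    spinProd σ s(u, v) = ((σ u : ℤ) : ℝ) * ((σ v : ℤ) : ℝ) := rfl

theorem spinProd_flipAt {n : ℕ} (σ : Config n) (v : Fin n) (e : Edge n) :
    spinProd (flipAt σ v) e = if v ∈ (e : Sym2 (Fin n)) then -spinProd σ e else spinProd σ e := by
  obtain ⟨e, he⟩ := e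
  induction e with
  | h x y =>
    have hxy : x ≠ y := by simpa using he
    simp only [spinProd_mk, flipAt, Sym2.mem_iff]
    by_cases hx : v = x
    · subst hx
      simp [Function.update_of_ne hxy.symm]
    · by_cases hy : v = y
      · subst hy
        simp [Function.update_of_ne hxy]
      · simp [hx, hy, Function.update_of_ne (Ne.symm hx), Function.update_of_ne (Ne.symm hy)]

theorem hamiltonian_flipAt_sub {n : ℕ} (w : Edge n → ℝ) (σ : Config n) (v : Fin n) :
    hamiltonian w (flipAt σ v) - hamiltonian w σ =
      ∑ e : Edge n, w e * (if v ∈ (e : Sym2 (Fin n)) then spinProd σ e else 0) := by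
  simp only [hamiltonian, ← mul_sub, ← Finset.sum_sub_distrib, Finset.mul_sum, spinProd_flipAt]
  refine Finset.sum_congr rfl fun e _ => ?_
  split_ifs <;> ring

theorem configAt_succ {n : ℕ} (σ : Config n) (L : List (Fin n)) {t : ℕ} (ht : t < L.length) :
    configAt σ L (t + 1) = flipAt (configAt σ L t) L[t] := by
  rw [configAt, configAt, List.take_succ_eq_append_getElem ht, List.foldl_append]
  rfl

section Block

variable {n : ℕ} {ι : Type*} [LinearOrder ι] [Fintype ι]

/-- The configuration reached from `σ` just before the move at position `i`, when the moves flip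
the spins at the vertices `b p`. -/
def spinsBefore (σ : Config n) (b : ι → Fin n) (i : ι) : Config n := fun u =>
  σ u * (-1) ^ (Finset.univ.filter fun p => p < i ∧ b p = u).card

theorem spinsBefore_of_next (σ : Config n) {b : ι → Fin n} {i j : ι} (h : IsNext b i j)
    (u : Fin n) :
    spinsBefore σ b j u = if u = b i then -spinsBefore σ b i u
      else spinsBefore σ b i u * (-1) ^ occ b u i j := by
  have hsplit : (Finset.univ.filter fun p => p < j ∧ b p = u) =
      (Finset.univ.filter fun p => p < i ∧ b p = u) ∪
        (Finset.univ.filter fun p => i ≤ p ∧ p < j ∧ b p = u) := by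
    ext p
    simp only [Finset.mem_filter, Finset.mem_univ, true_and, Finset.mem_union]
    rcases lt_or_ge p i with hp | hp
    · simp [hp, hp.trans h.1, not_le.2 hp]
    · simp [hp, not_lt.2 hp]
  have hdisj : Disjoint (Finset.univ.filter fun p => p < i ∧ b p = u)
      (Finset.univ.filter fun p => i ≤ p ∧ p < j ∧ b p = u) := by
    rw [Finset.disjoint_filter]
    exact fun p _ h1 h2 => absurd h1.1 (not_lt.2 h2.1)
  rw [spinsBefore, hsplit, Finset.card_union_of_disjoint hdisj, pow_add, ← mul_assoc]
  split_ifs with hu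
  · have : (Finset.univ.filter fun p => i ≤ p ∧ p < j ∧ b p = u) = {i} := by
      ext p
      simp only [Finset.mem_filter, Finset.mem_univ, true_and, Finset.mem_singleton]
      constructor
      · rintro ⟨h1, h2, h3⟩
        by_contra hne
        exact h.2.2 p (lt_of_le_of_ne h1 (Ne.symm hne)) h2 (h3.trans hu)
      · rintro rfl
        exact ⟨le_rfl, h.1, hu.symm⟩
    rw [this]
    simp [spinsBefore]
  · have : (Finset.univ.filter fun p => i ≤ p ∧ p < j ∧ b p = u) =
        Finset.univ.filter fun p => i < p ∧ p < j ∧ b p = u := by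
      refine Finset.filter_congr fun p _ => ⟨fun ⟨h1, h2, h3⟩ => ⟨?_, h2, h3⟩,
        fun ⟨h1, h2, h3⟩ => ⟨h1.le, h2, h3⟩⟩
      refine lt_of_le_of_ne h1 ?_
      rintro rfl
      exact hu h3.symm
    rw [this]
    rfl

/-- The coefficients of the sum of the increments of the Hamiltonian at the positions `i`, `j`,
where the same vertex is flipped, as a linear form in the edge weights. -/
noncomputable def gapForm (σ : Config n) (b : ι → Fin n) (i j : ι) (e : Edge n) : ℝ :=
  if b i ∈ (e : Sym2 (Fin n)) then
    spinProd (spinsBefore σ b i) e + spinProd (spinsBefore σ b j) e else 0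

/-- From `i` to `j` the spin at `b i` is reversed exactly once, so the two products cancel when `u`
returns to its old spin and agree when it does not. -/
theorem gapForm_mk (σ : Config n) {b : ι → Fin n} {i j : ι} (h : IsNext b i j) (u : Fin n)
    (hu : s(b i, u) ∈ (⊤ : SimpleGraph (Fin n)).edgeSet) :
    gapForm σ b i j ⟨s(b i, u), hu⟩ =
      if Odd (occ b u i j) then
        2 * (((spinsBefore σ b i (b i) : ℤ) : ℝ) * ((spinsBefore σ b i u : ℤ) : ℝ)) else 0 := by
  have hne : u ≠ b i := by
    rintro rfl
    simp at hu
  rw [gapForm, if_pos (Sym2.mem_mk_left _ _), spinProd_mk, spinProd_mk,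
    spinsBefore_of_next σ h, spinsBefore_of_next σ h, if_pos rfl, if_neg hne]
  split_ifs with ho
  · rw [ho.neg_one_pow]
    push_cast
    ring
  · rw [(Nat.not_odd_iff_even.1 ho).neg_one_pow]
    push_cast
    ring

theorem one_le_abs_gapForm (σ : Config n) {b : ι → Fin n} {i j : ι} (h : IsNext b i j)
    (u : Fin n) (hu : s(b i, u) ∈ (⊤ : SimpleGraph (Fin n)).edgeSet) (ho : Odd (occ b u i j)) :
    1 ≤ |gapForm σ b i j ⟨s(b i, u), hu⟩| := by
  rw [gapForm_mk σ h, if_pos ho]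
  rcases Int.units_eq_one_or (spinsBefore σ b i (b i)) with h1 | h1 <;>
  rcases Int.units_eq_one_or (spinsBefore σ b i u) with h2 | h2 <;>
  norm_num [h1, h2]

theorem inGap_of_gapForm_ne_zero {σ : Config n} {b : ι → Fin n} {i j : ι} (h : IsNext b i j)
    {x y : Fin n} {he : s(x, y) ∈ (⊤ : SimpleGraph (Fin n)).edgeSet}
    (h0 : gapForm σ b i j ⟨s(x, y), he⟩ ≠ 0) : InGap b i j x y := by
  have hmem : b i ∈ s(x, y) := by
    by_contra hn
    exact h0 (if_neg hn)
  rcases Sym2.mem_iff.1 hmem with rfl | rfl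
  · refine Or.inl ⟨rfl, ?_⟩
    by_contra ho
    exact h0 (by rw [gapForm_mk σ h, if_neg ho])
  · refine Or.inr ⟨rfl, ?_⟩
    by_contra ho
    refine h0 ?_
    have : (⟨s(x, b i), he⟩ : Edge n) = ⟨s(b i, x), Sym2.eq_swap ▸ he⟩ :=
      Subtype.ext Sym2.eq_swap
    rw [this, gapForm_mk σ h, if_neg ho]

/-- The gap forms depend only on the initial spins at the vertices that are flipped. -/
theorem gapForm_congr {σ τ : Config n} {b : ι → Fin n} (hστ : ∀ p, σ (b p) = τ (b p)) {i j : ι}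
    (h : IsNext b i j) : gapForm σ b i j = gapForm τ b i j := by
  ext ⟨e, he⟩
  induction e with
  | h x y =>
    by_cases hgap : InGap b i j x y
    · have hran : (∃ p, b p = x) ∧ ∃ p, b p = y := by
        rcases hgap with ⟨h1, h2⟩ | ⟨h1, h2⟩
        · obtain ⟨p, -, -, hp⟩ := occ_pos_iff.1 h2.pos
          exact ⟨⟨i, h1⟩, ⟨p, hp⟩⟩
        · obtain ⟨p, -, -, hp⟩ := occ_pos_iff.1 h2.pos
          exact ⟨⟨p, hp⟩, ⟨i, h1⟩⟩
      obtain ⟨⟨p, rfl⟩, ⟨q, rfl⟩⟩ := hran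
      simp only [gapForm, spinProd_mk, spinsBefore, hστ]
    · rw [not_imp_comm.1 (inGap_of_gapForm_ne_zero h) hgap,
        not_imp_comm.1 (inGap_of_gapForm_ne_zero h) hgap]

theorem IsPeelable.gapForm {b : ι → Fin n} {nx : ι → ι} {I : Finset ι}
    (hpeel : IsPeelable b nx I) (hnx : ∀ i ∈ I, IsNext b i (nx i)) (σ : Config n) :
    ∀ J ⊆ I, J.Nonempty → ∃ i ∈ J, ∃ e, 1 ≤ |gapForm σ b i (nx i) e| ∧
      ∀ j ∈ J, j ≠ i → gapForm σ b j (nx j) e = 0 := by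
  intro J hJ hne
  obtain ⟨i, hi, u, hu, ho, hgap⟩ := hpeel J hJ hne
  have he : s(b i, u) ∈ (⊤ : SimpleGraph (Fin n)).edgeSet := by simpa using hu.symm
  refine ⟨i, hi, ⟨s(b i, u), he⟩, one_le_abs_gapForm σ (hnx i (hJ hi)) u he ho, ?_⟩
  intro j hj hji
  by_contra h0
  exact hgap j hj hji (inGap_of_gapForm_ne_zero (hnx j (hJ hj)) h0)

/-- The sequence has length twice the number of its values and its proper intervals `B` satisfy
`|B| ≤ 2 |b '' B|`. -/
def IsCritical (b : ι → Fin n) : Prop :=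
  Fintype.card ι = 2 * (Finset.univ.image b).card ∧
  ∀ i j : ι, Finset.univ.filter (fun p => i ≤ p ∧ p ≤ j) ≠ Finset.univ →
    (Finset.univ.filter fun p => i ≤ p ∧ p ≤ j).card ≤
      2 * ((Finset.univ.filter fun p => i ≤ p ∧ p ≤ j).image b).card

/-- The weights for which all gap forms of a critical sequence take values in `(0, δ]`. -/
def gapEvent (δ : ℝ) (σ : Config n) (b : ι → Fin n) : Set (Edge n → ℝ) :=
  {w | IsCritical b ∧ ∀ i j, IsNext b i j →
    0 < ∑ e, w e * gapForm σ b i j e ∧ ∑ e, w e * gapForm σ b i j e ≤ δ}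

/-- Under a product measure whose factors have density at most `c`, the event `gapEvent δ σ b` has
probability at most `(c δ) ^ k` for some `k` at least an eighth of the length of `b`. -/
theorem pi_gapEvent_le (ν : Edge n → Measure ℝ) [∀ e, IsProbabilityMeasure (ν e)]
    (c : ENNReal) (hν : ∀ e S, ν e S ≤ c * volume S) (δ : ℝ) (σ : Config n) (b : ι → Fin n) :
    ∃ k : ℕ, Fintype.card ι ≤ 8 * k ∧
      Measure.pi ν (gapEvent δ σ b) ≤ (c * ENNReal.ofReal δ) ^ k := by
  rcases (gapEvent δ σ b).eq_empty_or_nonempty with hemp | ⟨w, hcrit, hw⟩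
  · exact ⟨Fintype.card ι, by omega, by simp [hemp]⟩
  -- A point of the event makes every gap form strictly positive, hence nonzero; this is where
  -- strict improvement is needed.
  · have hodd : ∀ i j, IsNext b i j → ∃ u ≠ b i, Odd (occ b u i j) := by
      intro i j hij
      obtain ⟨⟨e, he⟩, -, hne⟩ := Finset.exists_ne_zero_of_sum_ne_zero (hw i j hij).1.ne'
      have h0 := right_ne_zero_of_mul hne
      induction e with
      | h x y =>
        have hxy : x ≠ y := by simpa using he
        rcases inGap_of_gapForm_ne_zero hij h0 with ⟨rfl, ho⟩ | ⟨rfl, ho⟩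
        · exact ⟨y, hxy.symm, ho⟩
        · exact ⟨x, hxy, ho⟩
    obtain ⟨nx, I, hnx, hpeel, hI⟩ := exists_isPeelable b hcrit.1 hcrit.2 hodd
    refine ⟨I.card, hI, ?_⟩
    refine (measure_mono fun x hx => ?_).trans
      (pi_slab_le ν c hν (fun i => gapForm σ b i (nx i)) δ I (hpeel.gapForm hnx σ))
    exact fun i hi => hx.2 i _ (hnx i hi)

end Block

/-! ### From a slowly improving sequence to a critical block. -/

theorem configAt_add {n : ℕ} (σ : Config n) (L : List (Fin n)) (a m : ℕ)
    (b : Fin m → Fin n) (hm : a + m ≤ L.length)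
    (hb : ∀ i : Fin m, b i = L[a + i]'(by omega)) (i : Fin m) :
    configAt σ L (a + i) = spinsBefore (configAt σ L a) b i := by
  have key : ∀ k : ℕ, k ≤ m → ∀ u, configAt σ L (a + k) u = configAt σ L a u *
      (-1) ^ (Finset.univ.filter fun p : Fin m => (p : ℕ) < k ∧ b p = u).card := by
    intro k
    induction k with
    | zero => simp
    | succ k ih =>
      intro hk u
      have hk' : k < m := hk
      have hins : (Finset.univ.filter fun p : Fin m => (p : ℕ) < k + 1 ∧ b p = u) =
          (Finset.univ.filter fun p : Fin m => (p : ℕ) < k ∧ b p = u) ∪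
            (Finset.univ.filter fun p : Fin m => p = ⟨k, hk'⟩ ∧ b p = u) := by
        ext p
        simp only [Finset.mem_filter, Finset.mem_univ, true_and, Finset.mem_union, Fin.ext_iff]
        rw [← or_and_right, Nat.lt_succ_iff_lt_or_eq]
      have hdisj : Disjoint (Finset.univ.filter fun p : Fin m => (p : ℕ) < k ∧ b p = u)
          (Finset.univ.filter fun p : Fin m => p = ⟨k, hk'⟩ ∧ b p = u) := by
        rw [Finset.disjoint_filter]
        rintro p - h1 ⟨rfl, -⟩
        exact lt_irrefl _ h1.1
      rw [← add_assoc, configAt_succ σ L (by omega), hins, Finset.card_union_of_disjoint hdisj,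
        pow_add, ← mul_assoc, ← ih hk'.le u, ← hb ⟨k, hk'⟩, flipAt]
      by_cases hu : u = b ⟨k, hk'⟩
      · have : (Finset.univ.filter fun p : Fin m => p = ⟨k, hk'⟩ ∧ b p = u) = {⟨k, hk'⟩} := by
          ext p
          simp only [Finset.mem_filter, Finset.mem_univ, true_and, Finset.mem_singleton,
            and_iff_left_iff_imp]
          rintro rfl
          exact hu.symm
        rw [this, ← hu, Function.update_self]
        simp
      · have : (Finset.univ.filter fun p : Fin m => p = ⟨k, hk'⟩ ∧ b p = u) = ∅ := by
          rw [Finset.filter_eq_empty_iff]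
          rintro p - ⟨rfl, h⟩
          exact hu h.symm
        rw [this, Function.update_of_ne hu]
        simp
  ext1 u
  exact key i i.2.le u

/-- In a slowly improving sequence, the gap forms of every block lie in `(0, 2 ε]`. -/
theorem IsSlowlyImproving.gapForm {n : ℕ} {w : Edge n → ℝ} {ε : ℝ} {σ : Config n}
    {L : List (Fin n)} (h : IsSlowlyImproving w ε σ L) (a m : ℕ)
    (b : Fin m → Fin n) (hm : a + m ≤ L.length)
    (hb : ∀ i : Fin m, b i = L[a + i]'(by omega)) {i j : Fin m} (hij : IsNext b i j) :
    0 < ∑ e, w e * gapForm (configAt σ L a) b i j e ∧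
      ∑ e, w e * gapForm (configAt σ L a) b i j e ≤ 2 * ε := by
  have hinc : ∀ k : Fin m, hamiltonian w (configAt σ L (a + k + 1)) -
      hamiltonian w (configAt σ L (a + k)) = ∑ e : Edge n, w e *
        (if b k ∈ (e : Sym2 (Fin n)) then spinProd (spinsBefore (configAt σ L a) b k) e else 0) :=
    fun k => by
      rw [configAt_succ σ L (by omega), hamiltonian_flipAt_sub, configAt_add σ L a m b hm hb k,
        ← hb k]
  have hsum : ∑ e, w e * _root_.gapForm (configAt σ L a) b i j e =
      (hamiltonian w (configAt σ L (a + i + 1)) - hamiltonian w (configAt σ L (a + i))) +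
      (hamiltonian w (configAt σ L (a + j + 1)) - hamiltonian w (configAt σ L (a + j))) := by
    rw [hinc, hinc, ← Finset.sum_add_distrib]
    refine Finset.sum_congr rfl fun e _ => ?_
    rw [_root_.gapForm, hij.2.1]
    split_ifs <;> ring
  have h1 := h (a + i) (by omega)
  have h2 := h (a + j) (by omega)
  rw [hsum]
  constructor <;> linarith [h1.1, h1.2, h2.1, h2.2]

/-- A sequence of `2 n ≥ 2` moves on `n` vertices contains a critical block. -/
theorem exists_isCritical {n : ℕ} (hn : 0 < n) (L : List (Fin n)) (hL : L.length = 2 * n) :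
    ∃ (a m : ℕ) (b : Fin m → Fin n) (hm : a + m ≤ L.length), 0 < m ∧
      (∀ i : Fin m, b i = L[a + i]'(by omega)) ∧ IsCritical b := by
  classical
  set v : ℕ → Fin n := fun t => L.getD t ⟨0, hn⟩
  have hex : ∃ m, 0 < m ∧ ∃ a, a + m ≤ 2 * n ∧ 2 * ((Finset.Ico a (a + m)).image v).card ≤ m := by
    refine ⟨2 * n, by omega, 0, by omega, ?_⟩
    have := Finset.card_le_univ ((Finset.Ico 0 (0 + 2 * n)).image v)
    rw [Fintype.card_fin] at this
    omega
  obtain ⟨hm0, a, ham, hcard⟩ := Nat.find_spec hex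
  have hmin := fun k => Nat.find_min hex (m := k)
  generalize Nat.find hex = m at *
  have himg : ∀ (A : Finset (Fin m)) (k l : ℕ), (∀ p : Fin m, p ∈ A ↔ k ≤ a + p ∧ a + p < l) →
      a ≤ k → l ≤ a + m → A.image (fun i : Fin m => v (a + i)) = (Finset.Ico k l).image v := by
    intro A k l hA hk hl
    ext x
    simp only [Finset.mem_image, Finset.mem_Ico]
    constructor
    · rintro ⟨p, hp, rfl⟩
      exact ⟨a + p, (hA p).1 hp, rfl⟩
    · rintro ⟨t, ht, rfl⟩
      have e : a + (t - a) = t := by omega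
      exact ⟨⟨t - a, by omega⟩, (hA _).2 (by simpa [e] using ht), by simp [e]⟩
  refine ⟨a, m, fun i => v (a + i), by omega, hm0, fun i => ?_, ?_, ?_⟩
  · exact List.getD_eq_getElem _ _ _
  · rw [himg Finset.univ a (a + m) (fun p => by simp) le_rfl le_rfl, Fintype.card_fin]
    by_contra hne
    have hpos : 0 < ((Finset.Ico a (a + m)).image v).card :=
      ((Finset.nonempty_Ico.2 (by omega)).image v).card_pos
    -- If the length exceeded twice the number of values, dropping the last position would leave a
    -- shorter admissible block.
    refine hmin (m - 1) (by omega) ⟨by omega, a, by omega, ?_⟩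
    have : ((Finset.Ico a (a + (m - 1))).image v).card ≤ ((Finset.Ico a (a + m)).image v).card :=
      Finset.card_le_card (Finset.image_subset_image (Finset.Ico_subset_Ico_right (by omega)))
    omega
  · intro i j hij
    rw [himg (Finset.univ.filter fun p => i ≤ p ∧ p ≤ j) (a + i) (a + j + 1)
      (fun p => by
        rw [Finset.mem_filter, Fin.le_def, Fin.le_def, and_iff_right (Finset.mem_univ p)]
        omega) (by omega) (by omega)]
    have hAcard : (Finset.univ.filter fun p => i ≤ p ∧ p ≤ j).card = (j : ℕ) + 1 - i := by
      rw [← Fin.card_Icc]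
      congr 1
      ext p
      simp
    rcases lt_or_ge j i with h | h
    · rw [hAcard, Nat.sub_eq_zero_of_le (by exact h)]
      exact Nat.zero_le _
    · have hlt : (j : ℕ) + 1 - i < m := by
        have h1 := Finset.card_lt_card (Finset.ssubset_univ_iff.2 hij)
        rwa [hAcard, Finset.card_univ, Fintype.card_fin] at h1
      have h' : (i : ℕ) ≤ j := h
      by_contra hcon
      refine hmin _ hlt ⟨by omega, a + i, by omega, ?_⟩
      have e : a + (i : ℕ) + (j + 1 - i) = a + j + 1 := by omega
      rw [e]
      omega

/-- Initial spins given at the positions of a sequence of vertices, and `1` elsewhere. -/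
noncomputable def extendSpins {n m : ℕ} (b : Fin m → Fin n) (g : Fin m → ℤˣ) : Config n := by
  classical exact fun u => if h : ∃ p, b p = u then g h.choose else 1

theorem extendSpins_comp {n m : ℕ} (b : Fin m → Fin n) (σ : Config n) (p : Fin m) :
    extendSpins b (fun i => σ (b i)) (b p) = σ (b p) := by
  have h : ∃ q, b q = b p := ⟨p, rfl⟩
  rw [extendSpins, dif_pos h, h.choose_spec]

/-- Weights that admit a slowly improving sequence of `2 n` moves lie in one of the gap events. -/
theorem exists_mem_gapEvent {n : ℕ} (hn : 0 < n) {w : Edge n → ℝ} {ε : ℝ} {σ : Config n}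
    {L : List (Fin n)} (hL : L.length = 2 * n) (h : IsSlowlyImproving w ε σ L) :
    ∃ m ∈ Finset.Icc 1 (2 * n), ∃ bg : (Fin m → Fin n) × (Fin m → ℤˣ),
      w ∈ gapEvent (2 * ε) (extendSpins bg.1 bg.2) bg.1 := by
  obtain ⟨a, m, b, hm, hm0, hb, hcrit⟩ := exists_isCritical hn L hL
  refine ⟨m, Finset.mem_Icc.2 ⟨hm0, by omega⟩, (b, fun i => configAt σ L a (b i)), hcrit, ?_⟩
  intro i j hij
  rw [gapForm_congr (extendSpins_comp b (configAt σ L a)) hij]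
  exact h.gapForm a m b hm hb hij

/-! ### Probability of a single block, and the union bound. -/

namespace IsSmoothedWeights

variable {n : ℕ} {Ω : Type*} [MeasurableSpace Ω] {P : Measure Ω} {X : Edge n → Ω → ℝ} {φ : ℝ}

theorem map_apply_le (h : IsSmoothedWeights P X φ) (e : Edge n) (S : Set ℝ) :
    P.map (X e) S ≤ ENNReal.ofReal φ * volume S := by
  have := h.hasPDF e
  rw [map_eq_withDensity_pdf (X e) P volume]
  calc volume.withDensity (pdf (X e) P volume) S
      ≤ volume.withDensity (fun _ => ENNReal.ofReal φ) S := withDensity_mono (h.density_le e) S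
    _ = _ := by rw [withDensity_const, Measure.smul_apply, smul_eq_mul]

/-- A density at most `φ` carries total mass `1` on an interval of length `2`. This absorbs negative
powers of `φ` into a constant. -/
theorem half_le [IsProbabilityMeasure P] (h : IsSmoothedWeights P X φ) (e : Edge n) :
    1 / 2 ≤ φ := by
  have := h.hasPDF e
  have hm : AEMeasurable (X e) P := HasPDF.aemeasurable' volume
  have h1 : P.map (X e) (Set.Icc (-1) 1) = 1 := by
    rw [Measure.map_apply_of_aemeasurable hm measurableSet_Icc, ← measure_univ (μ := P)]
    refine measure_congr (eventuallyEq_univ.2 ?_)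
    filter_upwards [h.bounded e] with ω hω
    exact abs_le.1 hω
  have h2 := h.map_apply_le e (Set.Icc (-1) 1)
  rw [h1, Real.volume_Icc] at h2
  by_contra! hφ
  have : ENNReal.ofReal φ * ENNReal.ofReal (1 - -1) < 1 := by
    rw [← ENNReal.ofReal_mul' (by norm_num), ENNReal.ofReal_lt_one]
    linarith
  exact absurd h2 (not_le.2 this)

theorem measure_gapEvent_le [IsProbabilityMeasure P] (h : IsSmoothedWeights P X φ) (δ : ℝ)
    {m : ℕ} (σ : Config n) (b : Fin m → Fin n) {y : ENNReal} (hy : y ≤ 1)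
    (hδ : ENNReal.ofReal φ * ENNReal.ofReal δ ≤ y ^ 8) :
    P {ω | (fun e => X e ω) ∈ gapEvent δ σ b} ≤ y ^ m := by
  have hm : ∀ e, AEMeasurable (X e) P := fun e =>
    have := h.hasPDF e
    HasPDF.aemeasurable' volume
  have : ∀ e, IsProbabilityMeasure (P.map (X e)) := fun e => Measure.isProbabilityMeasure_map (hm e)
  obtain ⟨k, hk, hle⟩ := pi_gapEvent_le (fun e => P.map (X e)) _ h.map_apply_le δ σ b
  rw [Fintype.card_fin] at hk
  calc P {ω | (fun e => X e ω) ∈ gapEvent δ σ b}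
      ≤ P.map (fun ω e => X e ω) (gapEvent δ σ b) :=
        Measure.le_map_apply (aemeasurable_pi_lambda _ hm) _
    _ = Measure.pi (fun e => P.map (X e)) (gapEvent δ σ b) := by
        rw [(iIndepFun_iff_map_fun_eq_pi_map hm).1 h.indep]
    _ ≤ (ENNReal.ofReal φ * ENNReal.ofReal δ) ^ k := hle
    _ ≤ (y ^ 8) ^ k := by gcongr
    _ = y ^ (8 * k) := (pow_mul _ _ _).symm
    _ ≤ y ^ m := pow_le_pow_right_of_le_one' hy hk

/-- The union bound over all blocks and all initial spins on them. -/
theorem measure_exists_slowlyImproving_le [IsProbabilityMeasure P] (h : IsSmoothedWeights P X φ)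
    (hn : 0 < n) (ε : ℝ) {y : ℝ} (hy0 : 0 ≤ y) (hy : 4 * n * y ≤ 1)
    (hε : φ * (2 * ε) ≤ y ^ 8) (hφ : 0 ≤ φ) :
    P {ω | ∃ (σ₀ : Config n) (L : List (Fin n)), L.length = 2 * n ∧
      IsSlowlyImproving (fun e => X e ω) ε σ₀ L} ≤ ENNReal.ofReal (4 * n * y) := by
  have hn1 : (1 : ℝ) ≤ n := by exact_mod_cast hn
  have hy1 : y ≤ 1 := by nlinarith
  have hsub : {ω | ∃ (σ₀ : Config n) (L : List (Fin n)), L.length = 2 * n ∧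
      IsSlowlyImproving (fun e => X e ω) ε σ₀ L} ⊆
      ⋃ m ∈ Finset.Icc 1 (2 * n), ⋃ bg : (Fin m → Fin n) × (Fin m → ℤˣ),
        {ω | (fun e => X e ω) ∈ gapEvent (2 * ε) (extendSpins bg.1 bg.2) bg.1} := by
    rintro ω ⟨σ, L, hL, hs⟩
    obtain ⟨m, hm, bg, hbg⟩ := exists_mem_gapEvent hn hL hs
    exact Set.mem_iUnion₂.2 ⟨m, hm, Set.mem_iUnion.2 ⟨bg, hbg⟩⟩
  have hδ : ENNReal.ofReal φ * ENNReal.ofReal (2 * ε) ≤ ENNReal.ofReal y ^ 8 := by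
    rw [← ENNReal.ofReal_mul hφ, ← ENNReal.ofReal_pow hy0]
    exact ENNReal.ofReal_le_ofReal hε
  -- The ratio `2 n y` is at most `1 / 2`, so the series is at most twice its first term; the factor
  -- `1 - 2⁻¹ ^ N` makes the induction close.
  have hgeom : ∀ N : ℕ, ∑ m ∈ Finset.Icc 1 N, (2 * n * y) ^ m ≤ 4 * n * y * (1 - 2⁻¹ ^ N) := by
    intro N
    induction N with
    | zero => simp
    | succ N ih =>
      rw [Finset.sum_Icc_succ_top (by omega)]
      have hz : (2 * n * y) ^ N ≤ 2⁻¹ ^ N := by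
        gcongr
        linarith
      have h0 : 0 ≤ 2 * n * y := by positivity
      have := mul_le_mul_of_nonneg_right hz h0
      rw [pow_succ, pow_succ]
      linarith
  calc _ ≤ _ := measure_mono hsub
    _ ≤ ∑ m ∈ Finset.Icc 1 (2 * n), P (⋃ bg : (Fin m → Fin n) × (Fin m → ℤˣ),
        {ω | (fun e => X e ω) ∈ gapEvent (2 * ε) (extendSpins bg.1 bg.2) bg.1}) :=
        measure_biUnion_finset_le _ _
    _ ≤ ∑ m ∈ Finset.Icc 1 (2 * n), ENNReal.ofReal ((2 * n * y) ^ m) := by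
        refine Finset.sum_le_sum fun m _ => ?_
        refine (measure_iUnion_fintype_le P _).trans ?_
        refine (Finset.sum_le_sum fun bg _ => h.measure_gapEvent_le (2 * ε) _ bg.1
          (ENNReal.ofReal_le_one.2 hy1) hδ).trans (le_of_eq ?_)
        -- Spins are indexed by positions rather than by distinct vertices, so the count is `n ^ m *
        -- 2 ^ m` for every block length.
        rw [Finset.sum_const, Finset.card_univ, Fintype.card_prod, Fintype.card_fun,
          Fintype.card_fun, Fintype.card_fin, Fintype.card_fin, Fintype.card_units_int,
          ← mul_pow, nsmul_eq_mul, ← ENNReal.ofReal_pow hy0, ← ENNReal.ofReal_natCast,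
          ← ENNReal.ofReal_mul (by positivity), Nat.cast_pow, ← mul_pow]
        push_cast
        ring_nf
    _ = ENNReal.ofReal (∑ m ∈ Finset.Icc 1 (2 * n), (2 * n * y) ^ m) :=
        (ENNReal.ofReal_sum_of_nonneg fun m _ => by positivity).symm
    _ ≤ ENNReal.ofReal (4 * n * y) := by
        refine ENNReal.ofReal_le_ofReal ((hgeom _).trans ?_)
        refine mul_le_of_le_one_right (by positivity) ?_
        linarith [pow_nonneg (by norm_num : (0 : ℝ) ≤ 2⁻¹) (2 * n)]

end IsSmoothedWeights

theorem propositionP (η : ℝ) (hη : 0 < η) :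
    ∃ r : ℕ → ℝ, Tendsto r atTop (𝓝 0) ∧
      ∀ (n : ℕ) (Ω : Type*) [MeasurableSpace Ω] (P : Measure Ω) [IsProbabilityMeasure P]
        (φ : ℝ) (X : Edge n → Ω → ℝ), IsSmoothedWeights P X φ →
        1 - r n ≤ P.real {ω | ¬ ∃ (σ₀ : Config n) (L : List (Fin n)), L.length = 2 * n ∧
          IsSlowlyImproving (fun e => X e ω)
            ((n : ℝ) ^ (-(12 + η)) * φ ^ (-5 : ℤ)) σ₀ L} := by
  refine ⟨fun n => if n = 0 then 1 else 8 * (n : ℝ) ^ (-(η / 8)), ?_, ?_⟩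
  · have h1 : Tendsto (fun n : ℕ => 8 * (n : ℝ) ^ (-(η / 8))) atTop (𝓝 0) := by
      simpa using ((tendsto_rpow_neg_atTop (by positivity : 0 < η / 8)).comp
        tendsto_natCast_atTop_atTop).const_mul 8
    refine h1.congr' ?_
    filter_upwards [eventually_ne_atTop 0] with n hn
    rw [if_neg hn]
  · intro n Ω _ P _ φ X h
    rcases Nat.eq_zero_or_pos n with rfl | hn
    · simp
    simp only [hn.ne', if_false]
    have hn0 : (0 : ℝ) < n := by exact_mod_cast hn
    rcases lt_or_ge 1 (8 * (n : ℝ) ^ (-(η / 8))) with hbig | hsmall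
    · linarith [measureReal_nonneg (μ := P) (s := {ω | ¬ ∃ (σ₀ : Config n) (L : List (Fin n)),
        L.length = 2 * n ∧ IsSlowlyImproving (fun e => X e ω)
            ((n : ℝ) ^ (-(12 + η)) * φ ^ (-5 : ℤ)) σ₀ L})]
    -- For `n = 1` the claimed error would be `8 > 1`. With `n ≥ 2` there is an edge, which yields
    -- `φ ≥ 1 / 2`.
    have hn2 : 2 ≤ n := by
      by_contra hlt
      obtain rfl : n = 1 := by omega
      norm_num at hsmall
    have he : s((⟨0, by omega⟩ : Fin n), ⟨1, by omega⟩) ∈ (⊤ : SimpleGraph (Fin n)).edgeSet := by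
      simp
    have hφ := h.half_le ⟨_, he⟩
    -- Chosen so that `y ^ 8 = 256 n ^ (-(8 + η))` dominates `2 φ ε`, while `4 n y` still tends to
    -- `0`.
    set y : ℝ := 2 * (n : ℝ) ^ (-(1 + η / 8)) with hy
    have hny : 4 * n * y = 8 * (n : ℝ) ^ (-(η / 8)) := by
      have : (n : ℝ) * (n : ℝ) ^ (-(1 + η / 8)) = (n : ℝ) ^ (-(η / 8)) := by
        rw [← Real.rpow_one_add' hn0.le (by linarith [div_pos hη (by norm_num : (0:ℝ) < 8)])]
        ring_nf
      rw [hy, ← this]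
      ring
    have hbound := h.measure_exists_slowlyImproving_le hn
      ((n : ℝ) ^ (-(12 + η)) * φ ^ (-5 : ℤ)) (y := y) (by positivity) (hny ▸ hsmall) ?_
      (by linarith)
    · rw [hny] at hbound
      set B := {ω | ∃ (σ₀ : Config n) (L : List (Fin n)), L.length = 2 * n ∧
          IsSlowlyImproving (fun e => X e ω)
            ((n : ℝ) ^ (-(12 + η)) * φ ^ (-5 : ℤ)) σ₀ L} with hB
      have h1 : P.real B ≤ 8 * (n : ℝ) ^ (-(η / 8)) :=
        ENNReal.toReal_le_of_le_ofReal (by positivity) hbound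
      have h2 : (1 : ℝ) ≤ P.real B + P.real Bᶜ := by
        rw [← probReal_univ (μ := P), ← Set.union_compl_self B]
        exact measureReal_union_le B Bᶜ
      change 1 - _ ≤ P.real Bᶜ
      linarith
    · have h8 : ((n : ℝ) ^ (-(1 + η / 8))) ^ 8 = (n : ℝ) ^ (-(8 + η)) := by
        rw [← Real.rpow_natCast, ← Real.rpow_mul hn0.le]
        congr 1
        push_cast
        ring
      -- The exponent `8 + η` is all that the argument uses.
      have h4 : (n : ℝ) ^ (-(12 + η)) ≤ (n : ℝ) ^ (-(8 + η)) :=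
        Real.rpow_le_rpow_of_exponent_le (by exact_mod_cast hn) (by linarith)
      have hφ4 : φ * φ ^ (-5 : ℤ) ≤ 16 := by
        have hφ0 : φ ≠ 0 := by linarith
        have : φ * φ ^ (-5 : ℤ) = (φ⁻¹) ^ 4 := by
          rw [← zpow_one_add₀ hφ0]
          norm_num [zpow_neg]
        rw [this]
        have h2 : φ⁻¹ ≤ 2 := by
          rw [inv_le_comm₀ (by linarith) (by norm_num)]
          linarith
        calc φ⁻¹ ^ 4 ≤ 2 ^ 4 := by
              gcongr
          _ = 16 := by norm_num
      calc φ * (2 * ((n : ℝ) ^ (-(12 + η)) * φ ^ (-5 : ℤ)))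
          = 2 * (n : ℝ) ^ (-(12 + η)) * (φ * φ ^ (-5 : ℤ)) := by ring
        _ ≤ 2 * (n : ℝ) ^ (-(8 + η)) * 16 := by gcongr
        _ ≤ y ^ 8 := by
          rw [hy, mul_pow, h8]
          have : 0 ≤ (n : ℝ) ^ (-(8 + η)) := by positivity
          linarith
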